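/- Let $(R,\mathfrak m)$ be a Cohen–Macaulay local ring with $\dim R = 1$. Let $\mu_R(M)$ and $\ell_R(M)$ denote the minimal number of generators and the length of an $R$-module $M$, let $\mathrm v(R)=\mu_R(\mathfrak m)$ be the embedding dimension of $R$, and let $\mathrm e(R)=\lim_{n\to\infty}\ell_R(R/\mathfrak m^n)/n$ be its multiplicity. An $\mathfrak m$-primary ideal $I$ of $R$ is called an Ulrich ideal if it contains a parameter ideal $Q=(a)$ of $R$ as a reduction such that $I\neq Q$, $I^2=QI$, and $I/I^2$ is a free $R/I$-module. Suppose that $\mathrm v(R)=\mathrm e(R)>1$. Then for every Ulrich ideal $I$ of $R$ we have $\mu_R(I)=\mathrm v(R)$, and $R/I$ is a Gorenstein ring. -/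

import Mathlib

namespace UlrichIdeals

universe u

/-- A Noetherian local ring `(R, 𝔪)` is Cohen-Macaulay if there is an `R`-regular sequence in `𝔪`
whose length is the Krull dimension of `R`, that is, `depth R = dim R`. -/
def IsCohenMacaulayLocalRing (R : Type u) [CommRing R] [IsLocalRing R] : Prop :=
  IsNoetherianRing R ∧
    ∃ rs : List R, (∀ r ∈ rs, r ∈ IsLocalRing.maximalIdeal R) ∧
      RingTheory.Sequence.IsRegular R rs ∧
      ((rs.length : ℕ) : WithBot ℕ∞) = ringKrullDim R

/-- A Gorenstein local ring: a Noetherian local ring which has finite injective dimension as a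
module over itself. -/
def IsGorensteinLocalRing (A : Type u) [CommRing A] : Prop :=
  IsNoetherianRing A ∧ IsLocalRing A ∧
    ∃ n : ℕ, CategoryTheory.HasInjectiveDimensionLE (ModuleCat.of A A) n

/-- `I` is `𝔪`-primary: its radical is the maximal ideal `𝔪`. -/
def IsMPrimary {R : Type u} [CommRing R] [IsLocalRing R] (I : Ideal R) : Prop :=
  I.radical = IsLocalRing.maximalIdeal R

/-- `Q` is a parameter ideal: an `𝔪`-primary ideal generated by `d = dim R` elements. -/
def IsParameterIdeal {R : Type u} [CommRing R] [IsLocalRing R] (Q : Ideal R) : Prop :=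
  ∃ (d : ℕ) (a : Fin d → R), (d : WithBot ℕ∞) = ringKrullDim R ∧
    Q = Ideal.span (Set.range a) ∧ IsMPrimary Q

/-- `Q` is a reduction of `I`. -/
def IsReduction {R : Type u} [CommRing R] (Q I : Ideal R) : Prop :=
  Q ≤ I ∧ ∃ n : ℕ, I ^ (n + 1) = Q * I ^ n

/-- Ulrich ideals of a (Cohen-Macaulay) local ring, of any dimension. Here `I.Cotangent` is
`I / I ^ 2` with its `R / I`-module structure. -/
def IsUlrichIdeal {R : Type u} [CommRing R] [IsLocalRing R] (I : Ideal R) : Prop :=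
  IsMPrimary I ∧
    ∃ Q : Ideal R, IsParameterIdeal Q ∧ IsReduction Q I ∧
      I ≠ Q ∧ I ^ 2 = Q * I ∧ Module.Free (R ⧸ I) I.Cotangent

/-- `e` is the multiplicity of a one-dimensional local ring `R` with respect to the `𝔪`-primary
ideal `𝔞`, that is, `e = lim_{n → ∞} ℓ_R(R / 𝔞 ^ n) / n`. -/
def HasMultiplicity {R : Type u} [CommRing R] (𝔞 : Ideal R) (e : ℝ) : Prop :=
  Filter.Tendsto (fun n : ℕ => ((Module.length R (R ⧸ 𝔞 ^ n)).toNat : ℝ) / (n : ℝ))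
    Filter.atTop (nhds e)

/-- The embedding dimension `v(R)`: the minimal number of generators of the maximal ideal. -/
noncomputable def embDim (R : Type u) [CommRing R] [IsLocalRing R] : ℕ :=
  (IsLocalRing.maximalIdeal R).spanFinrank

end UlrichIdeals

open IsLocalRing Polynomial

namespace UlrichIdeals

universe u

/-! ### Lengths of quotients by ideals. -/

section Colength

variable {A : Type*} [CommRing A]

/-! Write v = v(R) and Q = (a). If 𝔪 had a principal reduction (f), then v = e would force 𝔪² = f𝔪.
With a finite residue field f need not exist in R, so the argument passes to S = R(t), which
preserves colengths and principal colons, and takes for f a polynomial whose coefficients generate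
𝔪. Such an f is superficial, so the Hilbert function of S bounds the colength of (f) + 𝔪_S ^ (s+1)
by e for large s. A length count and Nakayama then give 𝔪_S² = f𝔪_S (`maximalIdeal_sq`), hence
ℓ(S/fS) = v.

Number of generators: freeness of I/I² makes a part of a minimal generating set a, x_i of I, with
(a) : x_i ⊆ I. Dividing by f then shows 𝔪IS = f·IS (`maximalIdeal_mul_map`). Taking colengths,
ℓ(R/𝔪I) = ℓ(R/I) + v, that is, μ(I) = v.

Gorenstein property: let W = (a) : 𝔪 and let n be the number of the x_i, so n ≥ v - 1. Freeness
embeds n copies of the socle of R/I into W/(a) (`length_quotient_add_le_of_socle`), while ℓ(W/(a)) ≤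
v - 1 (`length_quotient_le_add_colon`). So the socle of R/I has length at most one, and an Artinian
local ring with such a socle is self-injective. -/

/-- Multiplication by `f` induces an exact sequence `0 → A/(K : f) → A/K → A/(K + fA) → 0`. -/
theorem length_quotient_eq_add {K K' : Ideal A} {f : A} (h : ∀ x, f * x ∈ K ↔ x ∈ K') :
    Module.length A (A ⧸ K) =
      Module.length A (A ⧸ K') + Module.length A (A ⧸ (K ⊔ Ideal.span {f})) := by
  let φ : (A ⧸ K') →ₗ[A] (A ⧸ K) := Submodule.mapQ K' K (LinearMap.mulLeft A f)
    (fun x hx => (h x).2 hx)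
  let ψ : (A ⧸ K) →ₗ[A] (A ⧸ (K ⊔ Ideal.span {f})) := Submodule.factor le_sup_left
  refine Module.length_eq_add_of_exact φ ψ ?_ (Submodule.factor_surjective _) ?_
  · rw [← LinearMap.ker_eq_bot, LinearMap.ker_eq_bot']
    intro x hx
    obtain ⟨x, rfl⟩ := Submodule.Quotient.mk_surjective _ x
    change Submodule.Quotient.mk (f * x) = 0 at hx
    rw [Submodule.Quotient.mk_eq_zero] at hx
    rw [Submodule.Quotient.mk_eq_zero]
    exact (h x).1 hx
  · intro y
    obtain ⟨y, rfl⟩ := Submodule.Quotient.mk_surjective _ y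
    constructor
    · intro hy
      change Submodule.Quotient.mk y = 0 at hy
      rw [Submodule.Quotient.mk_eq_zero] at hy
      obtain ⟨k, hk, z, hz, rfl⟩ := Submodule.mem_sup.1 hy
      obtain ⟨c, rfl⟩ := Ideal.mem_span_singleton'.1 hz
      refine ⟨Submodule.Quotient.mk c, ?_⟩
      change Submodule.Quotient.mk (f * c) = _
      rw [Submodule.Quotient.eq]
      have : f * c - (k + c * f) = -k := by ring
      rw [this]
      exact K.neg_mem hk
    · rintro ⟨c, hc⟩
      obtain ⟨c, rfl⟩ := Submodule.Quotient.mk_surjective _ c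
      rw [← hc]
      change Submodule.Quotient.mk (f * c) = 0
      rw [Submodule.Quotient.mk_eq_zero]
      exact Submodule.mem_sup_right (Ideal.mul_mem_right _ _ (Ideal.mem_span_singleton_self f))

/-- Since f is regular, fJ : f = J, so this is the preceding sequence with K = fJ. -/
theorem length_quotient_span_mul {f : A} (hf : f ∈ nonZeroDivisors A) (J : Ideal A) :
    Module.length A (A ⧸ (Ideal.span {f} * J)) =
      Module.length A (A ⧸ J) + Module.length A (A ⧸ Ideal.span {f}) := by
  have := length_quotient_eq_add (K := Ideal.span {f} * J) (K' := J) (f := f) (by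
    intro x
    rw [Ideal.mem_span_singleton_mul]
    constructor
    · rintro ⟨z, hz, h⟩
      rwa [← mul_cancel_left_mem_nonZeroDivisors hf |>.1 h]
    · intro hx; exact ⟨x, hx, rfl⟩)
  rwa [sup_eq_right.2 Ideal.mul_le_left] at this

theorem length_quotient_anti {J K : Ideal A} (h : J ≤ K) :
    Module.length A (A ⧸ K) ≤ Module.length A (A ⧸ J) :=
  Module.length_le_of_surjective (Submodule.factor h) (Submodule.factor_surjective _)

theorem eq_of_length_quotient_le {J K : Ideal A} (h : J ≤ K)
    (hfin : Module.length A (A ⧸ J) ≠ ⊤)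
    (hle : Module.length A (A ⧸ J) ≤ Module.length A (A ⧸ K)) : J = K := by
  have h1 : Module.length A (A ⧸ J) =
      Module.length A (LinearMap.ker (Submodule.factor h)) + Module.length A (A ⧸ K) :=
    Module.length_eq_add_of_exact (LinearMap.ker (Submodule.factor h)).subtype
      (Submodule.factor h) (Submodule.subtype_injective _) (Submodule.factor_surjective _)
      (LinearMap.exact_subtype_ker_map _)
  have h2 : Module.length A (LinearMap.ker (Submodule.factor h)) = 0 := by
    rw [h1] at hle hfin
    have : Module.length A (A ⧸ K) ≠ ⊤ := fun h => hfin (by simp [h])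
    generalize Module.length A (LinearMap.ker (Submodule.factor h)) = a at *
    generalize Module.length A (A ⧸ K) = b at *
    lift b to ℕ using this
    have ha : a ≠ ⊤ := fun h => hfin (by simp [h])
    lift a to ℕ using ha
    norm_cast at *
    omega
  rw [Module.length_eq_zero_iff, Submodule.subsingleton_iff_eq_bot, LinearMap.ker_eq_bot'] at h2
  refine le_antisymm h fun x hx => ?_
  have := h2 (Submodule.Quotient.mk x) (by
    change Submodule.Quotient.mk x = 0
    rwa [Submodule.Quotient.mk_eq_zero])
  rwa [Submodule.Quotient.mk_eq_zero] at this

theorem length_quotient_maximalIdeal [IsLocalRing A] :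
    Module.length A (A ⧸ maximalIdeal A) = 1 := by
  rw [Module.length_eq_one_iff]
  exact isSimpleModule_iff_isCoatom.2 (Ideal.isMaximal_def.1 (maximalIdeal.isMaximal A))

theorem isFiniteLength_quotient_of_pow_le [IsLocalRing A] [IsNoetherianRing A] {J : Ideal A}
    {n : ℕ} (h : maximalIdeal A ^ n ≤ J) : IsFiniteLength A (A ⧸ J) := by
  rw [isFiniteLength_iff_isNoetherian_isArtinian]
  have key : IsArtinianRing (A ⧸ J) := by
    by_cases hJ : J = ⊤
    · subst hJ
      have : Subsingleton (A ⧸ (⊤ : Ideal A)) := Ideal.Quotient.subsingleton_iff.2 rfl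
      infer_instance
    apply quotient_artinian_of_mem_minimalPrimes_of_isLocalRing
    refine ⟨⟨inferInstance, le_maximalIdeal hJ⟩, ?_⟩
    rintro q ⟨hq, hJq⟩ -
    exact hq.le_of_pow_le (h.trans hJq)
  exact ⟨inferInstance, isArtinian_of_surjective_algebraMap
    (Ideal.Quotient.mk_surjective (I := J))⟩

theorem length_quotient_ne_top_of_pow_le [IsLocalRing A] [IsNoetherianRing A] {J : Ideal A}
    {n : ℕ} (h : maximalIdeal A ^ n ≤ J) : Module.length A (A ⧸ J) ≠ ⊤ :=
  Module.length_ne_top_iff.2 (isFiniteLength_quotient_of_pow_le h)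

end Colength

/-! ### Colons of large powers, and a superficial polynomial. -/

section RatliffRush

/-- If `I` contains a nonzerodivisor of the Noetherian ring `A`, then `I ^ (r + 1) : I = I ^ r`
for all large `r`. -/
theorem exists_colon_pow_le {A : Type*} [CommRing A] [IsNoetherianRing A] {I : Ideal A} {a : A}
    (haI : a ∈ I) (ha : a ∈ nonZeroDivisors A) :
    ∃ s, ∀ r ≥ s, ∀ x, (∀ m ∈ I, m * x ∈ I ^ (r + 1)) → x ∈ I ^ r := by
  -- Artin–Rees for (a): dividing by a costs at most k powers of I.
  obtain ⟨k, hk⟩ := Ideal.exists_pow_inf_eq_pow_smul I (Ideal.span {a})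
  have hAR : ∀ i x, a * x ∈ I ^ (i + k) → x ∈ I ^ i := by
    intro i x hx
    have h1 : a * x ∈ (I ^ (i + k) • (⊤ : Ideal A)) ⊓ Ideal.span {a} := by
      refine ⟨by simpa using hx, Ideal.mul_mem_right _ _ (Ideal.mem_span_singleton_self a)⟩
    rw [hk _ (by omega), Nat.add_sub_cancel] at h1
    have h2 : a * x ∈ I ^ i * Ideal.span {a} :=
      smul_mono_right _ (inf_le_right (a := I ^ k • (⊤ : Ideal A))) h1
    rw [mul_comm, Ideal.mem_span_singleton_mul] at h2
    obtain ⟨z, hz, h⟩ := h2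
    rwa [← mul_cancel_left_mem_nonZeroDivisors ha |>.1 h]
  -- N_i = I ^ (i+k+1) : I. The shift by k puts N_i inside I ^ i, so F is stable as a subfiltration
  -- of the I-adic one. Then N_(j+1) = I N_j for large j, and I N_j ⊆ I ^ (j+k+1) by definition of
  -- N_j.
  let F : I.Filtration A :=
    { N := fun i => { carrier := {x | ∀ m ∈ I, m * x ∈ I ^ (i + k + 1)}
                      add_mem' := fun hx hy m hm => by
                        rw [mul_add]; exact add_mem (hx m hm) (hy m hm)
                      zero_mem' := fun m _ => by simp
                      smul_mem' := fun c x hx m hm => by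
                        rw [smul_eq_mul, mul_left_comm]; exact Ideal.mul_mem_left _ _ (hx m hm) }
      mono := fun i x hx m hm => Ideal.pow_le_pow_right (by omega) (hx m hm)
      smul_le := fun i => by
        rw [Submodule.smul_le]
        intro r hr x hx m hm
        rw [smul_eq_mul, show i + 1 + k + 1 = (i + k + 1) + 1 by ring, pow_succ', mul_left_comm]
        exact Ideal.mul_mem_mul hr (hx m hm) }
  have hF : F.Stable := by
    refine (I.stableFiltration_stable ⊤).of_le fun i x hx => ?_
    have : x ∈ I ^ i := hAR i x (Ideal.pow_le_pow_right (by omega) (hx a haI))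
    simpa using this
  obtain ⟨n, hn⟩ := hF
  refine ⟨n + k + 1, fun r hr x hx => ?_⟩
  obtain ⟨j, rfl⟩ : ∃ j, r = j + k + 1 := ⟨r - k - 1, by omega⟩
  have h1 : x ∈ F.N (j + 1) := by
    intro m hm
    have := hx m hm
    rwa [show j + 1 + k + 1 = j + k + 1 + 1 by ring]
  rw [← hn j (by omega)] at h1
  refine (Submodule.smul_le.2 ?_) h1
  intro m hm y hy
  exact hy m hm

/-- The polynomial ∑ x_i t^i plays the role of a general element of I, whatever the residue field.
-/
theorem exists_span_range_coeff_eq {A : Type*} [CommRing A] {I : Ideal A} (hI : I.FG) :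
    ∃ f : A[X], Ideal.span (Set.range f.coeff) = I := by
  obtain ⟨n, x, rfl⟩ := Submodule.fg_iff_exists_fin_generating_family.1 hI
  refine ⟨∑ i : Fin n, monomial i (x i), ?_⟩
  have hc : ∀ j, (∑ i : Fin n, monomial (i : ℕ) (x i)).coeff j =
      if h : j < n then x ⟨j, h⟩ else 0 := by
    intro j
    simp only [finsetSum_coeff, coeff_monomial]
    split_ifs with h
    · rw [Finset.sum_eq_single ⟨j, h⟩]
      · simp
      · intro b _ hb
        rw [if_neg]
        rintro rfl; exact hb rfl
      · simp
    · apply Finset.sum_eq_zero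
      intro b _
      rw [if_neg]
      rintro rfl; exact h b.2
  apply le_antisymm
  · rw [Ideal.span_le]
    rintro _ ⟨j, rfl⟩
    rw [hc]
    split_ifs
    · exact Submodule.subset_span ⟨_, rfl⟩
    · exact zero_mem _
  · rw [Submodule.span_le]
    rintro _ ⟨i, rfl⟩
    refine Ideal.subset_span ⟨i, ?_⟩
    rw [hc]; simp

/-- A polynomial whose coefficients generate `I` is superficial for the powers of `I`. -/
theorem mem_map_C_pow_of_mul_mem {A : Type*} [CommRing A] {I : Ideal A} {f : A[X]}
    (hf : Ideal.span (Set.range f.coeff) = I) {s : ℕ}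
    (hs : ∀ r ≥ s, ∀ x, (∀ m ∈ I, m * x ∈ I ^ (r + 1)) → x ∈ I ^ r) {r : ℕ} (hr : s ≤ r)
    {g : A[X]} (hg : f * g ∈ (I ^ (r + 1)).map C) : g ∈ (I ^ r).map C := by
  have hfI : ∀ i, f.coeff i ∈ I := fun i => hf ▸ Ideal.subset_span ⟨i, rfl⟩
  have hfC : f ∈ I.map C := Ideal.mem_map_C_iff.2 hfI
  -- It suffices that each coefficient of f multiplies g into I ^ (r+1), because the coefficients
  -- generate I and `hs` cancels I. The induction is on a degree bound for g and, inside it,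
  -- downwards on the index i of the coefficient of f.
  suffices H : ∀ n, ∀ r ≥ s, ∀ g : A[X], (∀ j ≥ n, g.coeff j = 0) →
      f * g ∈ (I ^ (r + 1)).map C → ∀ i, C (f.coeff i) * g ∈ (I ^ (r + 1)).map C by
    have h1 := H (g.natDegree + 1) r hr g
      (fun j hj => coeff_eq_zero_of_natDegree_lt (by omega)) hg
    rw [Ideal.mem_map_C_iff]
    intro j
    refine hs r hr _ fun m hm => ?_
    rw [← hf] at hm
    induction hm using Submodule.span_induction with
    | mem x hx =>
      obtain ⟨i, rfl⟩ := hx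
      simpa using Ideal.mem_map_C_iff.1 (h1 i) j
    | zero => simp
    | add x y _ _ hx hy => rw [add_mul]; exact add_mem hx hy
    | smul c x _ hx => rw [smul_mul_assoc]; exact Submodule.smul_mem _ _ hx
  intro n
  induction n with
  | zero =>
    intro r _ g hg _ i
    have : g = 0 := by ext j; simpa using hg j (Nat.zero_le j)
    simp [this]
  | succ N ih =>
    intro r hr g hgN hfg
    suffices H : ∀ k i, f.natDegree < i + k → C (f.coeff i) * g ∈ (I ^ (r + 1)).map C from
      fun i => H (f.natDegree + 1) i (by omega)
    intro k
    induction k with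
    | zero =>
      intro i hi
      rw [coeff_eq_zero_of_natDegree_lt (by omega)]; simp
    | succ k ihk =>
      intro i hi
      -- In the coefficient of fg at i + N, every other term has either a coefficient of f of index
      -- above i, already treated, or a vanishing coefficient of g.
      have hlead : f.coeff i * g.coeff N ∈ I ^ (r + 1) := by
        have h1 := Ideal.mem_map_C_iff.1 hfg (i + N)
        rw [coeff_mul, ← Finset.add_sum_erase _ _
          (Finset.HasAntidiagonal.mem_antidiagonal.2 (rfl : (i, N).1 + (i, N).2 = i + N))] at h1
        refine (Ideal.add_mem_iff_left _ ?_).1 h1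
        refine Ideal.sum_mem _ fun p hp => ?_
        obtain ⟨hne, hp⟩ := Finset.mem_erase.1 hp
        rw [Finset.HasAntidiagonal.mem_antidiagonal] at hp
        rcases lt_trichotomy p.2 N with h | h | h
        · have := Ideal.mem_map_C_iff.1 (ihk p.1 (by omega)) p.2
          simpa using this
        · exact absurd (Prod.ext (by dsimp; omega) h) hne
        · rw [hgN _ (by omega)]; simp
      set g' := g - monomial N (g.coeff N) with hg'
      have hsplit : C (f.coeff i) * g = C (f.coeff i) * g' + monomial N (f.coeff i * g.coeff N) := by
        rw [hg', mul_sub, C_mul_monomial]; ring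
      have hmono : monomial N (f.coeff i * g.coeff N) ∈ (I ^ (r + 1)).map C := by
        rw [← C_mul_X_pow_eq_monomial]
        exact Ideal.mul_mem_right _ _ (Ideal.mem_map_of_mem _ hlead)
      have hfh : f * (C (f.coeff i) * g') ∈ (I ^ (r + 1 + 1)).map C := by
        have : f * (C (f.coeff i) * g') = C (f.coeff i) * (f * g) -
            f * monomial N (f.coeff i * g.coeff N) := by
          rw [eq_sub_iff_add_eq, ← mul_add, ← hsplit]; ring
        rw [this, pow_succ', Ideal.map_mul]
        exact sub_mem (Ideal.mul_mem_mul (Ideal.mem_map_of_mem _ (hfI i)) hfg)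
          (Ideal.mul_mem_mul hfC hmono)
      -- The outer induction is applied to f_i g', of smaller degree bound, one power higher; `hs`
      -- then loses that power again.
      have h2 := ih (r + 1) (by omega) (C (f.coeff i) * g') (by
        intro j hj
        rw [coeff_C_mul, hg', coeff_sub, coeff_monomial]
        rcases eq_or_lt_of_le hj with h | h
        · rw [if_pos h, ← h, sub_self, mul_zero]
        · rw [if_neg (by omega), hgN j (by omega)]; simp) hfh
      have h3 : C (f.coeff i) * g' ∈ (I ^ (r + 1)).map C := by
        rw [Ideal.mem_map_C_iff]
        intro j
        refine hs (r + 1) (by omega) _ fun m hm => ?_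
        rw [← hf] at hm
        induction hm using Submodule.span_induction with
        | mem x hx =>
          obtain ⟨i, rfl⟩ := hx
          simpa using Ideal.mem_map_C_iff.1 (h2 i) j
        | zero => simp
        | add x y _ _ hx hy => rw [add_mul]; exact add_mem hx hy
        | smul c x _ hx => rw [smul_mul_assoc]; exact Submodule.smul_mem _ _ hx
      rw [hsplit]
      exact add_mem h3 hmono

end RatliffRush

/-! ### The generic extension R(t) and minimal multiplicity. -/

/-- A local extension `S` of the local ring `R` with `𝔪_R S = 𝔪_S`, preserving colengths and
colons of principal ideals, together with an element `f` of `𝔪_S` that is superficial for the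
powers of `𝔪_S`. -/
structure IsGenericExtension (R S : Type*) [CommRing R] [IsLocalRing R] [CommRing S] [IsLocalRing S]
    [Algebra R S] (f : S) : Prop where
  map_maximalIdeal : (maximalIdeal R).map (algebraMap R S) = maximalIdeal S
  length_quotient_map : ∀ J : Ideal R,
    Module.length S (S ⧸ J.map (algebraMap R S)) = Module.length R (R ⧸ J)
  mem_map_of_mul_eq : ∀ (a b : R) (J : Ideal R), (∀ x, x * b ∈ Ideal.span {a} → x ∈ J) →
    ∀ x y : S, x * algebraMap R S b = algebraMap R S a * y → x ∈ J.map (algebraMap R S)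
  mem : f ∈ maximalIdeal S
  exists_superficial : ∃ s, ∀ r ≥ s, ∀ x, f * x ∈ maximalIdeal S ^ (r + 1) → x ∈ maximalIdeal S ^ r

/-- The local ring `R(t)`, the localization of `R[t]` at `𝔪 R[t]`, is a generic extension. -/
theorem exists_isGenericExtension {R : Type*} [CommRing R] [IsLocalRing R] [IsNoetherianRing R]
    {a : R} (ham : a ∈ maximalIdeal R) (ha : a ∈ nonZeroDivisors R) :
    ∃ P : Ideal R[X], ∃ _ : P.IsPrime, ∃ f : Localization.AtPrime P,
      IsGenericExtension R (Localization.AtPrime P) f := by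
  let P : Ideal R[X] := (maximalIdeal R).map C
  have hP : P.IsPrime := Ideal.isPrime_map_C_of_isPrime
  let S := Localization.AtPrime P
  have hmap : ∀ J : Ideal R, J.map (algebraMap R S) = (J.map C).map (algebraMap R[X] S) := by
    intro J
    rw [Ideal.map_map]; rfl
  have hmax : (maximalIdeal R).map (algebraMap R S) = maximalIdeal S := by
    rw [hmap]; exact Localization.AtPrime.map_eq_maximalIdeal
  have hloc : IsLocalHom (algebraMap R S) := by
    refine ((local_hom_TFAE (algebraMap R S)).out 0 2).2 ?_
    exact hmax.le
  have hflat : Module.Flat R S := inferInstance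
  obtain ⟨f, hf⟩ := exists_span_range_coeff_eq (maximalIdeal R).fg_of_isNoetherianRing
  obtain ⟨s, hs⟩ := exists_colon_pow_le ham ha
  refine ⟨P, hP, algebraMap R[X] S f, hmax, ?_, ?_, ?_, s, ?_⟩
  · intro J
    -- Flat local base change multiplies lengths by ℓ(S/𝔪S), which is 1.
    rw [(Algebra.TensorProduct.quotIdealMapEquivTensorQuot S J).toLinearEquiv.length_eq,
      IsLocalRing.length_baseChange, hmax, length_quotient_maximalIdeal, mul_one]
  · intro a b J hJ x y hxy
    obtain ⟨p, u, rfl⟩ := IsLocalization.exists_mk'_eq P.primeCompl x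
    obtain ⟨q, v, rfl⟩ := IsLocalization.exists_mk'_eq P.primeCompl y
    rw [hmap, IsLocalization.mk'_mem_map_algebraMap_iff P.primeCompl]
    have e1 : algebraMap R S b = algebraMap R[X] S (C b) := rfl
    have e2 : algebraMap R S a = algebraMap R[X] S (C a) := rfl
    rw [e1, e2, mul_comm, IsLocalization.mul_mk'_eq_mk'_of_mul, IsLocalization.mul_mk'_eq_mk'_of_mul,
      IsLocalization.mk'_eq_iff_eq, IsLocalization.eq_iff_exists P.primeCompl] at hxy
    -- With denominators cleared, the relation lives in R[t], where multiplication by the constants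
    -- a and b acts coefficientwise.
    obtain ⟨c, hc⟩ := hxy
    refine ⟨c * v, P.primeCompl.mul_mem c.2 v.2, ?_⟩
    rw [Ideal.mem_map_C_iff]
    intro j
    apply hJ
    rw [Ideal.mem_span_singleton']
    refine ⟨((c : R[X]) * u * q).coeff j, ?_⟩
    rw [mul_comm, ← coeff_C_mul, ← coeff_mul_C]
    congr 1
    linear_combination -hc
  · rw [← hmax, hmap]
    exact Ideal.mem_map_of_mem _ (Ideal.mem_map_C_iff.2 fun i => hf ▸ Ideal.subset_span ⟨i, rfl⟩)
  · intro r hr x hx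
    obtain ⟨p, u, rfl⟩ := IsLocalization.exists_mk'_eq P.primeCompl x
    rw [← hmax, ← Ideal.map_pow, hmap] at hx ⊢
    rw [IsLocalization.mul_mk'_eq_mk'_of_mul,
      IsLocalization.mk'_mem_map_algebraMap_iff P.primeCompl] at hx
    rw [IsLocalization.mk'_mem_map_algebraMap_iff P.primeCompl]
    obtain ⟨c, hc, h⟩ := hx
    refine ⟨c, hc, mem_map_C_pow_of_mul_mem hf hs hr ?_⟩
    rwa [mul_left_comm] at h

namespace IsGenericExtension

variable {R S : Type*} [CommRing R] [IsLocalRing R] [CommRing S] [IsLocalRing S]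
    [Algebra R S] {f : S}

/-- If fx = 0, superficiality puts x in all high powers of 𝔪_S, and Krull's intersection theorem
gives x = 0. -/
theorem mem_nonZeroDivisors [IsNoetherianRing S] (h : IsGenericExtension R S f) :
    f ∈ nonZeroDivisors S := by
  rw [mem_nonZeroDivisors_iff_left]
  intro x hx
  obtain ⟨s, hs⟩ := h.exists_superficial
  have := Ideal.iInf_pow_eq_bot_of_isLocalRing (maximalIdeal S) (Ideal.IsPrime.ne_top inferInstance)
  rw [← Ideal.mem_bot, ← this, Ideal.mem_iInf]
  intro i
  exact Ideal.pow_le_pow_right (le_max_left i s) (hs (max i s) (le_max_right _ _) x (by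
    rw [hx]; exact zero_mem _))

theorem length_quotient_maximalIdeal_pow (h : IsGenericExtension R S f) (n : ℕ) :
    Module.length S (S ⧸ maximalIdeal S ^ n) = Module.length R (R ⧸ maximalIdeal R ^ n) := by
  rw [← h.length_quotient_map, Ideal.map_pow, h.map_maximalIdeal]

/-- For large `s`, the colength of `f S + 𝔪_S ^ (s + 1)` is at most the multiplicity. -/
theorem length_quotient_span_sup_pow_le [IsNoetherianRing R] [IsNoetherianRing S]
    (h : IsGenericExtension R S f)
    {v : ℕ} (he : HasMultiplicity (maximalIdeal R) v) :
    ∃ s₀, ∀ s ≥ s₀,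
      Module.length S (S ⧸ (maximalIdeal S ^ (s + 1) ⊔ Ideal.span {f})) ≤ v := by
  obtain ⟨s₀, hs₀⟩ := h.exists_superficial
  refine ⟨s₀, fun s hs => ?_⟩
  have hstep : ∀ j ≥ s₀, Module.length S (S ⧸ maximalIdeal S ^ (j + 1)) =
      Module.length S (S ⧸ maximalIdeal S ^ j) +
        Module.length S (S ⧸ (maximalIdeal S ^ (j + 1) ⊔ Ideal.span {f})) := fun j hj =>
    length_quotient_eq_add fun x => ⟨hs₀ j hj x, fun hx => by
      rw [pow_succ']; exact Ideal.mul_mem_mul h.mem hx⟩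
  have hfin : Module.length S (S ⧸ (maximalIdeal S ^ (s + 1) ⊔ Ideal.span {f})) ≠ ⊤ :=
    length_quotient_ne_top_of_pow_le le_sup_left
  have hL : ∀ n, Module.length S (S ⧸ maximalIdeal S ^ n) =
      ((Module.length R (R ⧸ maximalIdeal R ^ n)).toNat : ℕ∞) := fun n => by
    rw [h.length_quotient_maximalIdeal_pow, ENat.natCast_toNat]
    exact length_quotient_ne_top_of_pow_le le_rfl
  lift Module.length S (S ⧸ (maximalIdeal S ^ (s + 1) ⊔ Ideal.span {f})) to ℕ using hfin with c hc
  unfold HasMultiplicity at he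
  set ℓ : ℕ → ℕ := fun n => (Module.length R (R ⧸ maximalIdeal R ^ n)).toNat with hℓ
  -- From s on, each step adds the colength of (f) + 𝔪_S ^ (j+1), which does not decrease with j and
  -- is c at j = s.
  have hgrow : ∀ k, k * c ≤ ℓ (s + k) := by
    intro k
    induction k with
    | zero => simp
    | succ k ih =>
      have h1 := hstep (s + k) (by omega)
      have h2 : (c : ℕ∞) ≤ Module.length S
          (S ⧸ (maximalIdeal S ^ (s + k + 1) ⊔ Ideal.span {f})) := by
        rw [hc]
        exact length_quotient_anti (sup_le_sup_right (Ideal.pow_le_pow_right (by omega)) _)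
      have h3 : ((ℓ (s + k) + c : ℕ) : ℕ∞) ≤ (ℓ (s + k + 1) : ℕ) := by
        rw [← hL (s + k + 1), h1, hL (s + k)]
        push_cast
        exact add_le_add_right h2 _
      rw [Nat.cast_le] at h3
      rw [← add_assoc]
      linarith
  rw [Nat.cast_le]
  have hlim : Filter.Tendsto (fun k : ℕ => (c : ℝ) - (s * c : ℝ) / k) Filter.atTop
      (nhds ((c : ℝ) - 0)) :=
    tendsto_const_nhds.sub (tendsto_const_nhds.div_atTop tendsto_natCast_atTop_atTop)
  have : (c : ℝ) - 0 ≤ v := by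
    refine le_of_tendsto_of_tendsto hlim he ?_
    filter_upwards [Filter.eventually_ge_atTop (s + 1)] with n hn
    have hn0 : (0 : ℝ) < n := by exact_mod_cast (by omega : 0 < n)
    rw [le_div_iff₀ hn0, sub_mul, div_mul_cancel₀ _ hn0.ne']
    have h4 := hgrow (n - s)
    rw [Nat.add_sub_cancel' (by omega)] at h4
    have h5 : (((n - s : ℕ) : ℝ)) * c ≤ (ℓ n : ℕ) := by exact_mod_cast h4
    rw [Nat.cast_sub (by omega)] at h5
    linarith
  rw [sub_zero] at this
  exact_mod_cast this

/-- If the embedding dimension `v` is equal to the multiplicity then `𝔪 S` has reduction number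
one with respect to `f`. -/
theorem maximalIdeal_sq [IsNoetherianRing R] [IsNoetherianRing S] (h : IsGenericExtension R S f)
    {v : ℕ} (he : HasMultiplicity (maximalIdeal R) v)
    (hv : Module.length R (R ⧸ maximalIdeal R ^ 2) = v + 1) :
    maximalIdeal S ^ 2 = Ideal.span {f} * maximalIdeal S := by
  obtain ⟨s₀, hs₀⟩ := h.length_quotient_span_sup_pow_le he
  set s := max s₀ 2
  -- The power 𝔪_S ^ (s+1) keeps the colength of K finite. Since K : f contains 𝔪_S, this colength
  -- is at most v + 1 = ℓ(S/𝔪_S²), so K = 𝔪_S²; Nakayama then removes the extra power.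
  set K := Ideal.span {f} * maximalIdeal S ⊔ maximalIdeal S ^ (s + 1) with hK
  have hf : Ideal.span {f} ≤ maximalIdeal S := by
    rw [Ideal.span_le]; simpa using h.mem
  have hKm : K ≤ maximalIdeal S ^ 2 := by
    refine sup_le ?_ (Ideal.pow_le_pow_right (by omega))
    rw [sq]
    exact Ideal.mul_mono_left hf
  have hKlen : Module.length S (S ⧸ K) ≤ v + 1 := by
    rw [length_quotient_eq_add (K := K) (K' := Submodule.comap (LinearMap.mulLeft S f) K) (f := f)
      (fun x => Iff.rfl), add_comm]
    refine add_le_add ?_ ?_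
    · have : K ⊔ Ideal.span {f} = maximalIdeal S ^ (s + 1) ⊔ Ideal.span {f} := by
        rw [hK, sup_right_comm,
          sup_eq_right.2 (Ideal.mul_le_left : Ideal.span {f} * maximalIdeal S ≤ _), sup_comm]
      rw [this]
      exact hs₀ s (le_max_left _ _)
    · rw [← length_quotient_maximalIdeal (A := S)]
      refine length_quotient_anti fun x hx => ?_
      exact Ideal.mem_sup_left (Ideal.mul_mem_mul (Ideal.mem_span_singleton_self f) hx)
  have hEq : K = maximalIdeal S ^ 2 := by
    refine eq_of_length_quotient_le hKm (length_quotient_ne_top_of_pow_le le_sup_right) ?_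
    rw [h.length_quotient_maximalIdeal_pow, hv]
    exact hKlen
  refine le_antisymm ?_ ?_
  · refine Submodule.le_of_le_smul_of_le_jacobson_bot (I := maximalIdeal S)
      (IsNoetherian.noetherian _) (jacobson_eq_maximalIdeal _ bot_ne_top).ge ?_
    rw [smul_eq_mul]
    conv_lhs => rw [← hEq]
    refine sup_le_sup_left ?_ _
    rw [← pow_succ']
    exact Ideal.pow_le_pow_right (by omega)
  · rw [sq]
    exact Ideal.mul_mono_left hf

end IsGenericExtension

/-! ### Self-injectivity from a small socle. -/

section Gorenstein

variable {A : Type*} [CommRing A] [IsLocalRing A]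

theorem length_hom_eq_add {A : Type*} [CommRing A] {M : Type*} [AddCommGroup M] [Module A M] (N : Submodule A M) :
    Module.length A (M →ₗ[A] A) = Module.length A ((M ⧸ N) →ₗ[A] A) +
      Module.length A (LinearMap.range (LinearMap.lcomp A A N.subtype)) := by
  let ρ : (M →ₗ[A] A) →ₗ[A] (N →ₗ[A] A) := LinearMap.lcomp A A N.subtype
  let ι : ((M ⧸ N) →ₗ[A] A) →ₗ[A] (M →ₗ[A] A) := LinearMap.lcomp A A N.mkQ
  refine Module.length_eq_add_of_exact ι ρ.rangeRestrict ?_ ρ.surjective_rangeRestrict ?_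
  · intro φ ψ h
    refine LinearMap.ext fun x => ?_
    obtain ⟨x, rfl⟩ := N.mkQ_surjective x
    exact LinearMap.congr_fun h x
  · rw [LinearMap.exact_iff, LinearMap.ker_rangeRestrict]
    refine le_antisymm (fun φ hφ => ?_) ?_
    · refine ⟨N.liftQ φ fun x hx => ?_, ?_⟩
      · exact LinearMap.congr_fun (LinearMap.mem_ker.1 hφ) ⟨x, hx⟩
      · exact LinearMap.ext fun x => rfl
    · rintro _ ⟨ψ, rfl⟩
      rw [LinearMap.mem_ker]
      refine LinearMap.ext fun x => ?_
      change ψ (N.mkQ x) = 0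
      rw [(Submodule.Quotient.mk_eq_zero N).2 x.2 |> (show N.mkQ (x : M) = 0 from ·), map_zero]

/-- A map from a simple module is determined by the image of one nonzero element, and that image is
killed by 𝔪. -/
theorem length_hom_le_one_of_simple (hsoc : Module.length A (maximalIdeal A).annihilator ≤ 1)
    {M : Type*} [AddCommGroup M] [Module A M] [IsSimpleModule A M] :
    Module.length A (M →ₗ[A] A) ≤ 1 := by
  have hann : Module.annihilator A M = maximalIdeal A :=
    eq_maximalIdeal (IsSimpleModule.annihilator_isMaximal (R := A) (M := M))
  have := IsSimpleModule.nontrivial A M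
  obtain ⟨m, hm⟩ := exists_ne (0 : M)
  let ev : (M →ₗ[A] A) →ₗ[A] (maximalIdeal A).annihilator :=
    LinearMap.codRestrict _ (LinearMap.applyₗ m) (fun φ => by
      rw [Submodule.mem_annihilator]
      intro r hr
      change φ m • r = 0
      rw [← hann, Module.mem_annihilator] at hr
      rw [smul_eq_mul, mul_comm, ← smul_eq_mul, ← map_smul, hr, map_zero])
  refine (Module.length_le_of_injective ev fun φ ψ h => LinearMap.ext fun x => ?_).trans hsoc
  have h0 : φ m = ψ m := congrArg Subtype.val h
  obtain ⟨c, rfl⟩ := IsSimpleModule.toSpanSingleton_surjective A hm x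
  simp [h0]

theorem length_hom_le (hsoc : Module.length A (maximalIdeal A).annihilator ≤ 1)
    {M : Type*} [AddCommGroup M] [Module A M] (hM : IsFiniteLength A M) :
    Module.length A (M →ₗ[A] A) ≤ Module.length A M := by
  induction hM with
  | of_subsingleton => simp
  | @of_simple_quotient M _ _ N _ _ ih =>
    rw [length_hom_eq_add N, Module.length_eq_add_of_exact N.subtype N.mkQ N.subtype_injective
      N.mkQ_surjective (LinearMap.exact_subtype_mkQ N), Module.length_eq_one A (M ⧸ N), add_comm]
    exact add_le_add ((Module.length_le_of_injective _ (Submodule.subtype_injective _)).trans ih)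
      (length_hom_le_one_of_simple hsoc)

/-- An Artinian local ring whose socle has length at most one is self-injective. -/
theorem injective_self_of_length_socle_le_one [IsArtinianRing A]
    (hsoc : Module.length A (maximalIdeal A).annihilator ≤ 1) : Module.Injective A A := by
  refine Module.Baer.injective fun J g => ?_
  let ρ : (A →ₗ[A] A) →ₗ[A] (J →ₗ[A] A) := LinearMap.lcomp A A J.subtype
  have hfl : ∀ (M : Type _) [AddCommGroup M] [Module A M] [Module.Finite A M],
      IsFiniteLength A M := fun M _ _ _ =>
    isFiniteLength_iff_isNoetherian_isArtinian.2 ⟨inferInstance, inferInstance⟩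
  have h1 : Module.length A (A →ₗ[A] A) =
      Module.length A ((A ⧸ J) →ₗ[A] A) + Module.length A (LinearMap.range ρ) :=
    length_hom_eq_add J
  have h2 : Module.length A (A →ₗ[A] A) = Module.length A A :=
    (LinearMap.ringLmapEquivSelf A A A).length_eq
  have h3 : Module.length A A = Module.length A J + Module.length A (A ⧸ J) :=
    Module.length_eq_add_of_exact J.subtype J.mkQ J.subtype_injective J.mkQ_surjective
      (LinearMap.exact_subtype_mkQ J)
  have h4 : Module.length A (J →ₗ[A] A) ≤ Module.length A J := length_hom_le hsoc (hfl J)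
  have h5 : Module.length A ((A ⧸ J) →ₗ[A] A) ≤ Module.length A (A ⧸ J) :=
    length_hom_le hsoc (hfl (A ⧸ J))
  have h6 : Module.length A (J →ₗ[A] A) =
      Module.length A (LinearMap.range ρ) + Module.length A ((J →ₗ[A] A) ⧸ LinearMap.range ρ) :=
    Module.length_eq_add_of_exact _ _ (Submodule.subtype_injective _) (Submodule.mkQ_surjective _)
      (LinearMap.exact_subtype_mkQ _)
  have hJt : Module.length A J ≠ ⊤ := Module.length_ne_top_iff.2 (hfl J)
  have hQt : Module.length A (A ⧸ J) ≠ ⊤ := Module.length_ne_top_iff.2 (hfl (A ⧸ J))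
  -- The bounds for J and A/J add up to ℓ(A) = ℓ(Hom(A, A)), so both are equalities and restriction
  -- to J is onto: this is Baer's criterion.
  have h7 : Module.length A ((J →ₗ[A] A) ⧸ LinearMap.range ρ) = 0 := by
    rw [h2, h3] at h1
    rw [h6] at h4
    generalize Module.length A ((J →ₗ[A] A) ⧸ LinearMap.range ρ) = p at *
    generalize Module.length A (LinearMap.range ρ) = q at *
    generalize Module.length A ((A ⧸ J) →ₗ[A] A) = r at *
    lift Module.length A J to ℕ using hJt with j
    lift Module.length A (A ⧸ J) to ℕ using hQt with k
    have hp : p ≠ ⊤ := by rintro rfl; simp at h4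
    have hq : q ≠ ⊤ := by rintro rfl; simp at h4
    have hr : r ≠ ⊤ := by rintro rfl; simp at h5
    lift p to ℕ using hp
    lift q to ℕ using hq
    lift r to ℕ using hr
    norm_cast at *
    omega
  rw [Module.length_eq_zero_iff, Submodule.Quotient.subsingleton_iff] at h7
  obtain ⟨φ, hφ⟩ : g ∈ LinearMap.range ρ := h7 ▸ Submodule.mem_top
  exact ⟨φ, fun x hx => LinearMap.congr_fun hφ ⟨x, hx⟩⟩

theorem isGorensteinLocalRing_of_length_socle_le_one {A : Type*} [CommRing A] [IsLocalRing A]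
    [IsArtinianRing A] (hsoc : Module.length A (maximalIdeal A).annihilator ≤ 1) :
    IsGorensteinLocalRing A := by
  have := injective_self_of_length_socle_le_one hsoc
  have : CategoryTheory.Injective (ModuleCat.of A A) :=
    Module.injective_object_of_injective_module A A
  refine ⟨inferInstance, inferInstance, 0, ?_⟩
  exact CategoryTheory.injective_iff_hasInjectiveDimensionLT_one.1 this

end Gorenstein

/-! ### Minimal generators and the free module I/I². -/

section Generators

variable {R : Type*} [CommRing R] [IsLocalRing R]

theorem length_quotient_maximalIdeal_mul {I : Ideal R} (hI : I.FG) :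
    Module.length R (R ⧸ (maximalIdeal R * I)) = Module.length R (R ⧸ I) + I.spanFinrank := by
  have : Module.Finite R I := Module.Finite.iff_fg.2 hI
  let T : Submodule R I := maximalIdeal R • ⊤
  have hT : T.map I.subtype = maximalIdeal R * I := by
    rw [Submodule.map_smul'', Submodule.map_top, Submodule.range_subtype, smul_eq_mul]
  let φ : (I ⧸ T) →ₗ[R] (R ⧸ (maximalIdeal R * I)) :=
    Submodule.mapQ T _ I.subtype (by rw [← hT]; exact Submodule.le_comap_map _ _)
  have hlen : Module.length R (I ⧸ T) = I.spanFinrank := by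
    rw [spanFinrank_eq_finrank_quotient I hI]
    let _ : Field (R ⧸ maximalIdeal R) := Ideal.Quotient.field _
    let _ : Module (R ⧸ maximalIdeal R) (I ⧸ T) :=
      inferInstanceAs (Module (R ⧸ maximalIdeal R) (I ⧸ (maximalIdeal R • (⊤ : Submodule R I))))
    have : IsScalarTower R (R ⧸ maximalIdeal R) (I ⧸ T) :=
      inferInstanceAs (IsScalarTower R (R ⧸ maximalIdeal R)
        (I ⧸ (maximalIdeal R • (⊤ : Submodule R I))))
    have : Module.Finite (R ⧸ maximalIdeal R) (I ⧸ T) :=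
      Module.Finite.of_restrictScalars_finite R _ _
    rw [Module.length_eq_of_surjective (S := R) (R := R ⧸ maximalIdeal R)
      Ideal.Quotient.mk_surjective]
    exact Module.length_eq_finrank _ _
  rw [← hlen, add_comm]
  refine Module.length_eq_add_of_exact φ (Submodule.factor Ideal.mul_le_right) ?_
    (Submodule.factor_surjective _) ?_
  · rw [← LinearMap.ker_eq_bot, LinearMap.ker_eq_bot']
    intro x hx
    obtain ⟨x, rfl⟩ := T.mkQ_surjective x
    change Submodule.Quotient.mk (x : R) = 0 at hx
    rw [Submodule.Quotient.mk_eq_zero, ← hT] at hx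
    obtain ⟨y, hy, hxy⟩ := hx
    rw [Subtype.ext hxy] at hy
    exact (Submodule.Quotient.mk_eq_zero T).2 hy
  · intro y
    obtain ⟨y, rfl⟩ := Submodule.Quotient.mk_surjective _ y
    change Submodule.Quotient.mk y = 0 ↔ _
    rw [Submodule.Quotient.mk_eq_zero]
    constructor
    · intro hy
      exact ⟨Submodule.Quotient.mk ⟨y, hy⟩, rfl⟩
    · rintro ⟨z, hz⟩
      obtain ⟨z, rfl⟩ := T.mkQ_surjective z
      change Submodule.Quotient.mk (z : R) = _ at hz
      rw [Submodule.Quotient.eq] at hz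
      have := I.sub_mem z.2 (Ideal.mul_le_right hz)
      rwa [sub_sub_cancel] at this

end Generators

/-- Given `I ^ 2 = a I ≠ 0`, the element `a` is part of a minimal generating system of `I` that
induces a basis of the free `R/I`-module `I/I ^ 2`. -/
theorem exists_generators_of_free_cotangent {R : Type u} [CommRing R] [IsLocalRing R]
    [IsNoetherianRing R] {I : Ideal R} {a : R} (haI : a ∈ I) (hI : I ≤ maximalIdeal R)
    (ha : a ∈ nonZeroDivisors R) (hsq : I ^ 2 = Ideal.span {a} * I) (hne : I ≠ Ideal.span {a})
    (hfree : Module.Free (R ⧸ I) I.Cotangent) :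
    ∃ (κ : Type u) (_ : Fintype κ) (_ : Nonempty κ) (x : κ → R), (∀ i, x i ∈ I) ∧
      I = Ideal.span {a} ⊔ Ideal.span (Set.range x) ∧
      ∀ (c : R) (s : κ → R), c * a + ∑ i, s i * x i ∈ I ^ 2 → ∀ i, s i ∈ I := by
  classical
  have : Module.Finite R I := Module.Finite.iff_fg.2 (IsNoetherian.noetherian I)
  have : Module.Finite R I.Cotangent :=
    Module.Finite.of_surjective I.toCotangent I.toCotangent_surjective
  have : Module.Finite (R ⧸ I) I.Cotangent := Module.Finite.of_restrictScalars_finite R _ _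
  let b := Module.Free.chooseBasis (R ⧸ I) I.Cotangent
  let ι := Module.Free.ChooseBasisIndex (R ⧸ I) I.Cotangent
  choose y hy using fun i => I.toCotangent_surjective (b i)
  have hsum : ∀ c : ι → R, I.toCotangent (∑ i, c i • y i) =
      ∑ i, (Ideal.Quotient.mk I (c i)) • b i := by
    intro c
    rw [map_sum]
    refine Finset.sum_congr rfl fun i _ => ?_
    rw [map_smul, hy]
    exact (algebraMap_smul (R ⧸ I) (c i) (b i)).symm
  have hcoe : ∀ c : ι → R, ((∑ i, c i • y i : I) : R) = ∑ i, c i * (y i : R) := by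
    intro c; simp
  have hindep : ∀ c : ι → R, ∑ i, c i * (y i : R) ∈ I ^ 2 → ∀ i, c i ∈ I := by
    intro c hc i
    rw [← hcoe, ← I.toCotangent_eq_zero, hsum] at hc
    exact Ideal.Quotient.eq_zero_iff_mem.1
      (Fintype.linearIndependent_iff.1 b.linearIndependent _ hc i)
  have hspan : ∀ z ∈ I, ∃ c : ι → R, z - ∑ i, c i * (y i : R) ∈ I ^ 2 := by
    intro z hz
    choose c hc using fun i => Ideal.Quotient.mk_surjective (b.repr (I.toCotangent ⟨z, hz⟩) i)
    refine ⟨c, ?_⟩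
    rw [← hcoe]
    change ((⟨z, hz⟩ : I) : R) - _ ∈ _
    rw [← AddSubgroupClass.coe_sub, ← I.toCotangent_eq_zero, map_sub, hsum, sub_eq_zero]
    simp_rw [hc]
    exact (b.sum_repr _).symm
  obtain ⟨α, hα⟩ := hspan a haI
  -- Otherwise a ∈ 𝔪I, so I² = aI ⊆ 𝔪I², and Nakayama gives I² = 0, against the regularity of a. The
  -- unit α i₀ lets a replace y i₀.
  obtain ⟨i₀, hi₀⟩ : ∃ i, α i ∉ maximalIdeal R := by
    by_contra! hcon
    have h1 : a ∈ maximalIdeal R * I := by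
      have h2 : ∑ i, α i * (y i : R) ∈ maximalIdeal R * I :=
        Ideal.sum_mem _ fun i _ => Ideal.mul_mem_mul (hcon i) (y i).2
      have h3 : I ^ 2 ≤ maximalIdeal R * I := by rw [sq]; exact Ideal.mul_mono_left hI
      have := add_mem (h3 hα) h2
      rwa [sub_add_cancel] at this
    have h4 : I ^ 2 ≤ maximalIdeal R • I ^ 2 := by
      conv_lhs => rw [hsq]
      rw [smul_eq_mul, sq, ← mul_assoc]
      exact Ideal.mul_mono_left ((Ideal.span_singleton_le_iff_mem _).2 h1)
    have h5 : I ^ 2 = ⊥ := Submodule.eq_bot_of_le_smul_of_le_jacobson_bot _ _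
      (IsNoetherian.noetherian _) h4 (jacobson_eq_maximalIdeal _ bot_ne_top).ge
    have h6 : a * a = 0 := by
      have : a ^ 2 ∈ I ^ 2 := Ideal.pow_mem_pow haI 2
      rwa [h5, Ideal.mem_bot, sq] at this
    exact zero_notMem_nonZeroDivisors (h6 ▸ mul_mem ha ha)
  obtain ⟨u, hu⟩ : ∃ u, u * α i₀ = 1 := by
    have := notMem_maximalIdeal.1 hi₀
    exact this.exists_left_inv
  let κ : Type u := {i : ι // i ≠ i₀}
  let x : κ → R := fun i => y i
  have hsplit : ∀ c : ι → R, ∑ i, c i * (y i : R) =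
      c i₀ * (y i₀ : R) + ∑ i : κ, c i * x i := by
    intro c
    exact Fintype.sum_eq_add_sum_subtype_ne _ i₀
  have hgen : I = Ideal.span {a} ⊔ Ideal.span (Set.range x) := by
    have hle : Ideal.span {a} ⊔ Ideal.span (Set.range x) ≤ I :=
      sup_le ((Ideal.span_singleton_le_iff_mem _).2 haI)
        (Ideal.span_le.2 (by rintro _ ⟨i, rfl⟩; exact (y i).2))
    refine le_antisymm ?_ hle
    refine Submodule.le_of_le_smul_of_le_jacobson_bot (I := maximalIdeal R)
      (IsNoetherian.noetherian _) (jacobson_eq_maximalIdeal _ bot_ne_top).ge ?_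
    have hsub : I ^ 2 ≤ maximalIdeal R • I := by
      rw [sq, smul_eq_mul]; exact Ideal.mul_mono_left hI
    have hx : ∀ c : ι → R, ∑ i : κ, c i * x i ∈
        Ideal.span {a} ⊔ Ideal.span (Set.range x) ⊔ maximalIdeal R • I := fun c =>
      Ideal.sum_mem _ fun i _ => Ideal.mul_mem_left _ _
        (Ideal.mem_sup_left (Ideal.mem_sup_right (Ideal.subset_span ⟨i, rfl⟩)))
    have hy₀ : (y i₀ : R) ∈
        Ideal.span {a} ⊔ Ideal.span (Set.range x) ⊔ maximalIdeal R • I := by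
      have : (y i₀ : R) = u * (a - ∑ i : κ, α i * x i
          - (a - ∑ i, α i * (y i : R))) := by
        rw [hsplit]; linear_combination -(y i₀ : R) * hu
      rw [this]
      refine Ideal.mul_mem_left _ _ (sub_mem (sub_mem ?_ (hx α)) (Ideal.mem_sup_right (hsub hα)))
      exact Ideal.mem_sup_left (Ideal.mem_sup_left (Ideal.mem_span_singleton_self a))
    intro z hz
    obtain ⟨c, hc⟩ := hspan z hz
    have hz' : z = (z - ∑ i, c i * (y i : R)) + (c i₀ * (y i₀ : R) + ∑ i : κ, c i * x i) := by
      rw [← hsplit]; ring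
    rw [hz']
    exact add_mem (Ideal.mem_sup_right (hsub hc)) (add_mem (Ideal.mul_mem_left _ _ hy₀) (hx c))
  refine ⟨κ, inferInstance, ?_, x, fun i => (y i).2, hgen, ?_⟩
  · by_contra hempty
    rw [not_nonempty_iff] at hempty
    apply hne
    rw [hgen, Set.range_eq_empty x, Ideal.span_empty, sup_bot_eq]
  · intro c s hcs
    -- Coordinates of c a + ∑ s_i x_i modulo I² in the original basis, after substituting a ≡ ∑ α_i
    -- y_i. The one at i₀ forces c ∈ I, and the others then force s_i ∈ I.
    let d : ι → R := fun i => if h : i = i₀ then c * α i₀ else c * α i + s ⟨i, h⟩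
    have hd : ∀ i : κ, d i = c * α i + s i := fun i => by simp [d, i.2]
    have hd₀ : d i₀ = c * α i₀ := by simp [d]
    have hmem : ∑ i, d i * (y i : R) ∈ I ^ 2 := by
      have : ∑ i, d i * (y i : R) = (c * a + ∑ i, s i * x i) -
          c * (a - ∑ i, α i * (y i : R)) := by
        rw [hsplit d, hsplit α, hd₀]
        simp_rw [hd, add_mul, Finset.sum_add_distrib, mul_assoc c, ← Finset.mul_sum]
        ring
      rw [this]
      exact sub_mem hcs (Ideal.mul_mem_left _ _ hα)
    have hdI := hindep d hmem
    have hc : c ∈ I := by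
      have : c = u * (c * α i₀) := by linear_combination -c * hu
      rw [this, ← hd₀]
      exact Ideal.mul_mem_left _ _ (hdI i₀)
    intro i
    have := sub_mem (hdI i) (I.mul_mem_right (α i) hc)
    rwa [hd, add_sub_cancel_left] at this

/-! ### Transfer to I, and the socle of R/I. -/

namespace IsGenericExtension

variable {R S : Type*} [CommRing R] [IsLocalRing R] [CommRing S] [IsLocalRing S]
    [Algebra R S] {f : S}

theorem length_quotient_span [IsNoetherianRing R] [IsNoetherianRing S]
    (h : IsGenericExtension R S f) (hsq : maximalIdeal S ^ 2 = Ideal.span {f} * maximalIdeal S)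
    {v : ℕ} (hv : Module.length R (R ⧸ maximalIdeal R ^ 2) = v + 1) :
    Module.length S (S ⧸ Ideal.span {f}) = v := by
  rw [← h.length_quotient_maximalIdeal_pow, hsq, length_quotient_span_mul h.mem_nonZeroDivisors,
    length_quotient_maximalIdeal, add_comm] at hv
  exact ENat.add_left_injective_of_ne_top ENat.one_ne_top hv

/-- If `𝔪_S ^ 2 = f 𝔪_S` and `I ^ 2 = a I`, where `I ≠ (a)` is as in the definition of an Ulrich
ideal, then `𝔪_S I = f I` in `S`. -/
theorem maximalIdeal_mul_map [IsNoetherianRing S] (h : IsGenericExtension R S f)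
    (hsq : maximalIdeal S ^ 2 = Ideal.span {f} * maximalIdeal S)
    {I : Ideal R} {a b : R} (hI : I ≤ maximalIdeal R)
    (hIsq : I ^ 2 = Ideal.span {a} * I) (hb : b ∈ I)
    (hcolon : ∀ x, x * b ∈ Ideal.span {a} → x ∈ I) :
    (maximalIdeal R * I).map (algebraMap R S) = Ideal.span {f} * I.map (algebraMap R S) := by
  have hIS : ∀ m ∈ maximalIdeal R, ∀ x ∈ I, ∃ z, algebraMap R S (m * x) = f * z := by
    intro m hm x hx
    have : algebraMap R S (m * x) ∈ maximalIdeal S ^ 2 := by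
      rw [map_mul, sq, ← h.map_maximalIdeal]
      exact Ideal.mul_mem_mul (Ideal.mem_map_of_mem _ hm) (Ideal.mem_map_of_mem _ (hI hx))
    rw [hsq] at this
    obtain ⟨z, -, hz⟩ := Ideal.mem_span_singleton_mul.1 this
    exact ⟨z, hz.symm⟩
  apply le_antisymm
  · rw [Ideal.map_le_iff_le_comap, Ideal.mul_le]
    intro m hm x hx
    rw [Ideal.mem_comap]
    obtain ⟨x', hx'⟩ := hIS m hm x hx
    have hxb : x * b ∈ I ^ 2 := by rw [sq]; exact Ideal.mul_mem_mul hx hb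
    rw [hIsq] at hxb
    obtain ⟨y, hy, hxy⟩ := Ideal.mem_span_singleton_mul.1 hxb
    obtain ⟨y', hy'⟩ := hIS m hm y hy
    -- With xb = ay, both sides times f equal mxb = amy; then f is cancelled.
    have key : x' * algebraMap R S b = algebraMap R S a * y' := by
      refine (mul_cancel_left_mem_nonZeroDivisors h.mem_nonZeroDivisors).1 ?_
      rw [← mul_assoc, ← hx', mul_left_comm, ← hy', ← map_mul, ← map_mul]
      congr 1
      linear_combination -m * hxy
    rw [hx']
    exact Ideal.mul_mem_mul (Ideal.mem_span_singleton_self f)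
      (h.mem_map_of_mul_eq a b I hcolon _ _ key)
  · rw [Ideal.map_mul, h.map_maximalIdeal]
    exact Ideal.mul_mono_left ((Ideal.span_singleton_le_iff_mem _).2 h.mem)

end IsGenericExtension

/-- The map (s_i) ↦ ∑ x_i s_i sends a power of the socle of R/I into ((a) : 𝔪)/(a), as x_i s_i 𝔪 ⊆
I² ⊆ (a). It is injective by the independence hypothesis `hindep`. -/
theorem length_quotient_add_le_of_socle {R : Type*} [CommRing R] [IsLocalRing R]
    [IsNoetherianRing R] {I : Ideal R} [IsLocalRing (R ⧸ I)] {a : R}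
    (hIsq : I ^ 2 = Ideal.span {a} * I)
    {κ : Type*} [Fintype κ] {x : κ → R} (hx : ∀ i, x i ∈ I)
    (hindep : ∀ (c : R) (s : κ → R), c * a + ∑ i, s i * x i ∈ I ^ 2 → ∀ i, s i ∈ I) :
    Module.length R (R ⧸ (Ideal.span {a}).colon (maximalIdeal R : Set R)) +
      Fintype.card κ * Module.length (R ⧸ I) (maximalIdeal (R ⧸ I)).annihilator ≤
      Module.length R (R ⧸ Ideal.span {a}) := by
  set W := (Ideal.span {a}).colon (maximalIdeal R : Set R) with hW
  let σ := (maximalIdeal (R ⧸ I)).annihilator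
  have hI2 : I ^ 2 ≤ Ideal.span {a} := hIsq ▸ Ideal.mul_le_left
  have haW : Ideal.span {a} ≤ W := fun z hz =>
    Submodule.mem_colon.2 fun m _ => Ideal.mul_mem_right _ _ hz
  let μ : κ → (R ⧸ I) →ₗ[R] (R ⧸ Ideal.span {a}) := fun i =>
    Submodule.mapQ I _ (LinearMap.mulLeft R (x i)) fun z hz =>
      hI2 (by rw [sq]; exact Ideal.mul_mem_mul (hx i) hz)
  have hμ : ∀ i s, μ i (Ideal.Quotient.mk I s) = Ideal.Quotient.mk _ (x i * s) := fun _ _ => rfl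
  let π : (R ⧸ Ideal.span {a}) →ₗ[R] (R ⧸ W) := Submodule.factor haW
  have hπ : ∀ z, π (Ideal.Quotient.mk _ z) = Ideal.Quotient.mk _ z := fun _ => rfl
  let φ : (κ → σ) →ₗ[R] (R ⧸ Ideal.span {a}) :=
    ∑ i, (μ i) ∘ₗ (σ.subtype.restrictScalars R) ∘ₗ LinearMap.proj i
  have hφ : ∀ z, φ z = ∑ i, μ i (z i) := fun z => by simp [φ]
  have hsoc : ∀ z : σ, ∀ s, Ideal.Quotient.mk I s = z → ∀ m ∈ maximalIdeal R, m * s ∈ I := by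
    intro z s hs m hm
    have h1 := Submodule.mem_annihilator.1 z.2 (Ideal.Quotient.mk I m) (by
      have := IsLocalHom.of_surjective (Ideal.Quotient.mk I) Ideal.Quotient.mk_surjective
      exact (mem_maximalIdeal _).2 fun hu => hm (isUnit_of_map_unit _ _ hu))
    rw [← hs, smul_eq_mul, mul_comm, ← map_mul] at h1
    exact Ideal.Quotient.eq_zero_iff_mem.1 h1
  let φ' : (κ → σ) →ₗ[R] LinearMap.ker π := φ.codRestrict _ (fun z => by
    rw [LinearMap.mem_ker, hφ, map_sum]
    refine Finset.sum_eq_zero fun i _ => ?_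
    obtain ⟨s, hs⟩ := Ideal.Quotient.mk_surjective (z i : R ⧸ I)
    rw [← hs, hμ, hπ, Ideal.Quotient.eq_zero_iff_mem, Submodule.mem_colon]
    intro m hm
    apply hI2
    rw [smul_eq_mul, mul_assoc, mul_comm s, sq]
    exact Ideal.mul_mem_mul (hx i) (hsoc _ s hs m hm))
  have hφ' : Function.Injective φ' := by
    refine (injective_iff_map_eq_zero φ').2 fun z hz => ?_
    have h0 : φ z = 0 := congrArg Subtype.val hz
    choose s hs using fun i => Ideal.Quotient.mk_surjective (z i : R ⧸ I)
    have h1 : Ideal.Quotient.mk (Ideal.span {a}) (∑ i, x i * s i) = 0 := by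
      rw [← h0, hφ, map_sum]
      exact Finset.sum_congr rfl fun i _ => by rw [← hs, hμ]
    rw [Ideal.Quotient.eq_zero_iff_mem, Ideal.mem_span_singleton'] at h1
    obtain ⟨c, hc⟩ := h1
    have h2 := hindep (-c) s (by
      simp_rw [mul_comm (s _), ← hc]
      simp)
    ext i
    rw [← hs, Ideal.Quotient.eq_zero_iff_mem.2 (h2 i)]
    rfl
  have hlen : Module.length R (R ⧸ Ideal.span {a}) =
      Module.length R (LinearMap.ker π) + Module.length R (R ⧸ W) :=
    Module.length_eq_add_of_exact (LinearMap.ker π).subtype π (Submodule.subtype_injective _)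
      (Submodule.factor_surjective _) (LinearMap.exact_subtype_ker_map _)
  have hpi : Module.length R (κ → σ) = Fintype.card κ * Module.length (R ⧸ I) σ := by
    rw [Module.length_pi_of_fintype, Finset.sum_const, Finset.card_univ, nsmul_eq_mul,
      Module.length_eq_of_surjective (S := R) (R := R ⧸ I) Ideal.Quotient.mk_surjective]
  rw [hlen, add_comm, ← hpi]
  exact add_le_add_left (Module.length_le_of_injective φ' hφ') _

/-! ### Parameters in dimension one, and the colon (a) : 𝔪. -/

section CohenMacaulay

variable {R : Type*} [CommRing R] [IsLocalRing R]

theorem IsCohenMacaulayLocalRing.exists_mem_nonZeroDivisors (hCM : IsCohenMacaulayLocalRing R)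
    (hdim : ringKrullDim R = 1) : ∃ w ∈ maximalIdeal R, w ∈ nonZeroDivisors R := by
  obtain ⟨-, rs, hrs, hreg, hlen⟩ := hCM
  rw [hdim] at hlen
  have hlen1 : rs.length = 1 := by exact_mod_cast hlen
  obtain ⟨w, rfl⟩ := List.length_eq_one_iff.1 hlen1
  refine ⟨w, hrs w (by simp), ?_⟩
  have := ((RingTheory.Sequence.isWeaklyRegular_cons_iff R w []).1 hreg.toIsWeaklyRegular).1
  rw [mem_nonZeroDivisors_iff_left]
  intro x hx
  exact this (by simpa using hx)

theorem IsParameterIdeal.exists_eq_span_singleton {Q : Ideal R} (hQ : IsParameterIdeal Q)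
    (hdim : ringKrullDim R = 1) : ∃ a, Q = Ideal.span {a} ∧ IsMPrimary Q := by
  obtain ⟨d, a, hd, hQa, hQm⟩ := hQ
  rw [hdim] at hd
  have hd1 : d = 1 := by exact_mod_cast hd
  subst hd1
  refine ⟨a 0, ?_, hQm⟩
  rw [hQa, Set.range_unique]
  rfl

/-- Some power of the regular element w is a multiple of a. -/
theorem IsMPrimary.mem_nonZeroDivisors {a w : R} (ha : IsMPrimary (Ideal.span {a}))
    (hwm : w ∈ maximalIdeal R) (hw : w ∈ nonZeroDivisors R) : a ∈ nonZeroDivisors R := by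
  rw [← show (Ideal.span {a}).radical = _ from ha] at hwm
  obtain ⟨n, hn⟩ := hwm
  obtain ⟨c, hc⟩ := Ideal.mem_span_singleton'.1 hn
  have h1 : c * a ∈ nonZeroDivisors R := hc ▸ pow_mem hw n
  exact (mul_mem_nonZeroDivisors.1 h1).2

theorem spanFinrank_le_card_add_one {R : Type*} [CommRing R] {I : Ideal R} {a : R} {κ : Type*} [Fintype κ] {x : κ → R}
    (hI : I = Ideal.span {a} ⊔ Ideal.span (Set.range x)) :
    I.spanFinrank ≤ Fintype.card κ + 1 := by
  rw [← Ideal.span_union] at hI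
  have hfin : (({a} : Set R) ∪ Set.range x).Finite :=
    (Set.finite_singleton a).union (Set.finite_range x)
  have h1 := Submodule.spanFinrank_span_le_ncard_of_finite (R := R) hfin
  have h2 : (Set.range x).ncard ≤ Fintype.card κ := by
    rw [← Set.image_univ, ← Nat.card_eq_fintype_card, ← Set.ncard_univ]
    exact Set.ncard_image_le
  have h3 := Set.ncard_union_le ({a} : Set R) (Set.range x)
  rw [Set.ncard_singleton] at h3
  rw [hI]
  exact h1.trans (by omega)

/-- If `𝔪` is not principal, then `𝔪 ((a) : 𝔪) ⊆ a 𝔪`. -/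
theorem colon_mul_maximalIdeal_le {a : R} (ha : a ∈ nonZeroDivisors R)
    (hv : 1 < embDim R) {w m : R} (hw : w ∈ (Ideal.span {a}).colon (maximalIdeal R : Set R))
    (hm : m ∈ maximalIdeal R) : w * m ∈ Ideal.span {a} * maximalIdeal R := by
  rw [Submodule.mem_colon] at hw
  obtain ⟨c, hc⟩ := Ideal.mem_span_singleton'.1 (hw m hm)
  rw [smul_eq_mul] at hc
  by_cases hcu : c ∈ maximalIdeal R
  · rw [← hc, mul_comm c]
    exact Ideal.mul_mem_mul (Ideal.mem_span_singleton_self a) hcu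
  · exfalso
    obtain ⟨u, hu⟩ := (notMem_maximalIdeal.1 hcu).exists_left_inv
    have hwreg : w ∈ nonZeroDivisors R := by
      have h1 : w * m ∈ nonZeroDivisors R :=
        hc ▸ mul_mem (notMem_maximalIdeal.1 hcu).mem_nonZeroDivisors ha
      exact (mul_mem_nonZeroDivisors.1 h1).1
    -- Here wm is a unit times a, so w𝔪 ⊆ (a) = (wm), and cancelling w makes 𝔪 principal.
    have hprin : maximalIdeal R = Ideal.span {m} := by
      refine le_antisymm (fun z hz => ?_) ((Ideal.span_singleton_le_iff_mem _).2 hm)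
      obtain ⟨d, hd⟩ := Ideal.mem_span_singleton'.1 (hw z hz)
      rw [smul_eq_mul] at hd
      refine Ideal.mem_span_singleton'.2 ⟨u * d, ?_⟩
      refine (mul_cancel_left_mem_nonZeroDivisors hwreg).1 ?_
      rw [← hd, show w * (u * d * m) = u * d * (w * m) by ring, ← hc]
      linear_combination d * a * hu
    have h1 : embDim R ≤ 1 := by
      rw [embDim, hprin]
      have := Submodule.spanFinrank_span_le_ncard_of_finite (R := R) (Set.finite_singleton m)
      rwa [Set.ncard_singleton] at this
    omega

/-- For W = (a) : 𝔪, one has f·WS ⊆ W𝔪S ⊆ a𝔪S. The two outer colengths are ℓ(R/W) + v and ℓ(R/(a)) +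
1. -/
theorem IsGenericExtension.length_quotient_le_add_colon {S : Type*} [CommRing S] [IsLocalRing S]
    [IsNoetherianRing S] [Algebra R S] {f : S} (h : IsGenericExtension R S f)
    (hq : Module.length S (S ⧸ Ideal.span {f}) = embDim R) {a : R} (ha : a ∈ nonZeroDivisors R)
    (hv : 1 < embDim R) :
    Module.length R (R ⧸ Ideal.span {a}) + 1 ≤
      Module.length R (R ⧸ (Ideal.span {a}).colon (maximalIdeal R : Set R)) + embDim R := by
  have h1 := length_quotient_span_mul ha (maximalIdeal R)
  rw [length_quotient_maximalIdeal, add_comm] at h1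
  rw [← h1, ← hq, ← h.length_quotient_map, ← h.length_quotient_map ((Ideal.span {a}).colon _),
    ← length_quotient_span_mul h.mem_nonZeroDivisors]
  refine length_quotient_anti ?_
  have h2 : (Ideal.span {a}).colon (maximalIdeal R : Set R) * maximalIdeal R ≤
      Ideal.span {a} * maximalIdeal R :=
    Ideal.mul_le.2 fun w hw m hm => colon_mul_maximalIdeal_le ha hv hw hm
  refine le_trans ?_ (Ideal.map_mono h2)
  rw [Ideal.map_mul, h.map_maximalIdeal, mul_comm]
  exact Ideal.mul_mono_right ((Ideal.span_singleton_le_iff_mem _).2 h.mem)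

end CohenMacaulay

end UlrichIdeals

/-! ### The main theorem. -/

open UlrichIdeals

theorem corollary3p2 {R : Type*} [CommRing R] [IsLocalRing R]
    (hCM : UlrichIdeals.IsCohenMacaulayLocalRing R) (hdim : ringKrullDim R = 1)
    (e : ℝ) (he : UlrichIdeals.HasMultiplicity (IsLocalRing.maximalIdeal R) e)
    (hve : (UlrichIdeals.embDim R : ℝ) = e) (he1 : 1 < e)
    (I : Ideal R) (hI : UlrichIdeals.IsUlrichIdeal I) :
    I.spanFinrank = UlrichIdeals.embDim R ∧
      UlrichIdeals.IsGorensteinLocalRing (R ⧸ I) := by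
  have hN : IsNoetherianRing R := hCM.1
  obtain ⟨w, hwm, hw⟩ := hCM.exists_mem_nonZeroDivisors hdim
  obtain ⟨hIrad, Q, hQ, hQI, hne, hsq, hfree⟩ := hI
  obtain ⟨a, rfl, hQm⟩ := hQ.exists_eq_span_singleton hdim
  have haI : a ∈ I := hQI.1 (Ideal.mem_span_singleton_self a)
  have ha := hQm.mem_nonZeroDivisors hwm hw
  have hIm : I ≤ maximalIdeal R := hIrad ▸ Ideal.le_radical
  have ham := hIm haI
  subst hve
  have hv1 : 1 < embDim R := by exact_mod_cast he1
  have hvlen : Module.length R (R ⧸ maximalIdeal R ^ 2) = embDim R + 1 := by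
    rw [sq, length_quotient_maximalIdeal_mul (IsNoetherian.noetherian _),
      length_quotient_maximalIdeal, add_comm]
    rfl
  obtain ⟨P, hP, f, h⟩ := exists_isGenericExtension ham ha
  have hSN : IsNoetherianRing (Localization.AtPrime P) :=
    IsLocalization.isNoetherianRing P.primeCompl _ inferInstance
  have hS := h.maximalIdeal_sq he hvlen
  have hq := h.length_quotient_span hS hvlen
  obtain ⟨κ, _, ⟨i₀⟩, x, hx, hgen, hindep⟩ :=
    exists_generators_of_free_cotangent haI hIm ha hsq hne hfree
  -- If z x_(i₀) = ca, then -ca + z x_(i₀) = 0 lies in I², and independence applies.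
  have hcolon : ∀ z, z * x i₀ ∈ Ideal.span {a} → z ∈ I := by
    classical
    intro z hz
    obtain ⟨c, hc⟩ := Ideal.mem_span_singleton'.1 hz
    simpa using hindep (-c) (Pi.single i₀ z) (by
      rw [Finset.sum_eq_single i₀ (fun b _ hb => by simp [hb]) (by simp)]
      simp [← hc]) i₀
  have hmI := h.maximalIdeal_mul_map hS hIm hsq (hx i₀) hcolon
  obtain ⟨k, hk⟩ := Ideal.exists_pow_le_of_le_radical_of_fg (hIrad.ge) (IsNoetherian.noetherian _)
  obtain ⟨l, hl⟩ := Ideal.exists_pow_le_of_le_radical_of_fg (show maximalIdeal R ≤ _ from hQm.ge)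
    (IsNoetherian.noetherian _)
  have hrank : I.spanFinrank = embDim R := by
    have h1 := length_quotient_maximalIdeal_mul (IsNoetherian.noetherian I)
    rw [← h.length_quotient_map, hmI, length_quotient_span_mul h.mem_nonZeroDivisors, hq,
      h.length_quotient_map] at h1
    have := ENat.add_right_injective_of_ne_top (length_quotient_ne_top_of_pow_le hk) h1
    exact_mod_cast this.symm
  refine ⟨hrank, ?_⟩
  have hcard : embDim R ≤ Fintype.card κ + 1 := by
    rw [← hrank]
    exact spanFinrank_le_card_add_one hgen
  have : Nontrivial (R ⧸ I) := Ideal.Quotient.nontrivial_iff.2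
    (fun h => Ideal.IsPrime.ne_top inferInstance (top_le_iff.1 (h ▸ hIm)))
  have hloc : IsLocalRing (R ⧸ I) :=
    IsLocalRing.of_surjective' (Ideal.Quotient.mk I) Ideal.Quotient.mk_surjective
  have hart : IsArtinianRing (R ⧸ I) := by
    have := (isFiniteLength_iff_isNoetherian_isArtinian.1
      (isFiniteLength_quotient_of_pow_le hk)).2
    exact isArtinian_of_tower R this
  apply isGorensteinLocalRing_of_length_socle_le_one
  have h1 := length_quotient_add_le_of_socle hsq hx hindep
  have h2 := h.length_quotient_le_add_colon hq ha hv1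
  have h3 : Module.length R (R ⧸ Ideal.span {a}) ≠ ⊤ := length_quotient_ne_top_of_pow_le hl
  have hκ : 0 < Fintype.card κ := Fintype.card_pos_iff.2 ⟨i₀⟩
  generalize Module.length (R ⧸ I) (maximalIdeal (R ⧸ I)).annihilator = σ at *
  generalize Module.length R (R ⧸ Ideal.span {a}) = p at *
  generalize Module.length R (R ⧸ (Ideal.span {a}).colon (maximalIdeal R : Set R)) = W at *
  lift p to ℕ using h3
  have hW : W ≠ ⊤ := by rintro rfl; simp at h1
  lift W to ℕ using hW
  have hσ : σ ≠ ⊤ := by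
    rintro rfl
    rw [ENat.mul_top (by exact_mod_cast hκ.ne')] at h1
    simp at h1
  lift σ to ℕ using hσ
  norm_cast at *
  -- With n = `Fintype.card κ`, the bounds read nσ ≤ p - W ≤ v - 1 ≤ n, and n > 0.
  nlinarith
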